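/- Let $n\ge 1$ and $\Gamma=\{(\alpha_1,\dots,\alpha_n)\in\mathbb{R}^n: 0\le\alpha_n\le\cdots\le\alpha_1\le 1\}$. Let $V$ be the $(n+1)\times(n+1)$ matrix whose entry in position $ij$ is $1$ if $i=n+1$, or if $j\ge2$ and $i+j\le n+2$, and is $0$ otherwise. The rows $1,\dots,n$ of its columns are the vertices $v_0,\dots,v_n$ of the simplex $\Gamma$. For $a=0,1$ let $B_a$ be the $(n+1)\times(n+1)$ matrix whose entries are $0$, except that the entries in position $(a+1)\,1$ and in the positions $(j+1)\,j$, $2\le j\le n$, are $1$, and the entries in positions $1\,(n+1)$ and $2\,(n+1)$ are $1/2$. Let $D_a=VB_aV^{-1}$, and let $\tau_a:\Gamma\to\Gamma$ be the affine map defined by $\tau_a(\alpha_1,\dots,\alpha_n)=(\beta_1,\dots,\beta_n)$ iff $D_a(\alpha_1,\dots,\alpha_n,1)^{tr}=(\beta_1,\dots,\beta_n,1)^{tr}$. The maps $\tau_0,\tau_1$ are the two inverse branches of the tent map $T:\Gamma\to\Gamma$, $$T(\alpha_1,\dots,\alpha_n)=\begin{cases}(\alpha_1+\alpha_n,\ \alpha_1-\alpha_n,\dots,\alpha_{n-1}-\alpha_n)&\text{if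 }\alpha_1+\alpha_n\le1,\\(2-\alpha_1-\alpha_n,\ \alpha_1-\alpha_n,\dots,\alpha_{n-1}-\alpha_n)&\text{if }\alpha_1+\alpha_n\ge1.\end{cases}$$ Let $\Gamma^o$ be the set of points $\sum_{i=0}^n x_iv_i$ with all $x_i\ge0$, $\sum_i x_i=1$ and $x_0>0$, and let $v_{-1}$ be the unique point of $\Gamma$ whose projective coordinates $(\alpha_1,\dots,\alpha_n,1)^{tr}$ form an eigenvector of $D_1$. The sets $\{v_{-1}\}$ and $\tau_1^k\tau_0\Gamma^o$, $k\ge0$, partition $\Gamma$, and the bijection $K:\Gamma\to\Gamma$ is defined by $Kv_{-1}=v_0$ and $K=\tau_0^k\tau_1(\tau_1^k\tau_0)^{-1}$ on $\tau_1^k\tau_0\Gamma^o$. The $K$-orbit of $p$ is $\{K^mp:m\in\mathbb{Z}\}$. For $a_0,\dots,a_{t-1}\in\{0,1\}$ let $\Gamma_{a_0\dots a_{t-1}}=\tau_{a_0}\cdots\tau_{a_{t-1}}\Gamma$. A sequence $\mathbf a\in\{0,1\}^{\mathbb N}$ is a symbolic orbit of $p\in\Gamma$ if $\bigcap_{t\ge0}\Gamma_{a_0\dots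 a_{t-1}}=\{p\}$; it is a final orbit of $p$ if, moreover, $a_t=1$ whenever $T^tp\in\Gamma_0\cap\Gamma_1$. The $*$-orbit of $p$ is the sequence $\mathbf c\in\{0,1,*\}^{\mathbb N}$ with $c_t=0$, $1$ or $*$ according to whether $T^tp$ belongs to $\Gamma_0\setminus\Gamma_1$, $\Gamma_1\setminus\Gamma_0$ or $\Gamma_0\cap\Gamma_1$. Two sequences $\mathbf a,\mathbf b$ have the same tail if there is $t\ge0$ with $a_r=b_r$ for all $r\ge t$; a sequence has tail $0^\infty$ (respectively $1^\infty$) if it has the same tail as the constant sequence $000\dots$ (respectively $111\dots$). Then every point of $\Gamma$ has exactly one final orbit and exactly one $*$-orbit, and two points $p,q\in\Gamma$ belong to the same $K$-orbit if and only if either their final orbits have the same tail, or one of these final orbits has tail $0^\infty$ and the other has tail $1^\infty$. The same equivalence holds if the final orbits of $p$ and $q$ are replaced by any symbolic orbit of $p$ and any symbolic orbit of $q$, and also if they are replaced by the $*$-orbits of $p$ and $q$. -/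

import Mathlib

noncomputable section

namespace KakutaniTent

/-- The `n`-dimensional simplex `0 ≤ α_n ≤ ⋯ ≤ α_1 ≤ 1` in `ℝ^n`
(the coordinate `α_i` is `α (i - 1)`). -/
def Gam (n : ℕ) : Set (Fin n → ℝ) :=
  {α | (∀ i, 0 ≤ α i) ∧ (∀ i, α i ≤ 1) ∧ ∀ i j, i ≤ j → α j ≤ α i}

/-- The matrix `V`, with rows and columns numbered from `0` to `n`. -/
def V (n : ℕ) : Matrix (Fin (n + 1)) (Fin (n + 1)) ℝ :=
  Matrix.of fun i j => if i.val = n ∨ (1 ≤ j.val ∧ i.val + j.val ≤ n) then 1 else 0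

/-- The matrices `A_0` and `A_1`, with rows and columns numbered from `0` to `n`. -/
def A (n : ℕ) (a : Fin 2) : Matrix (Fin (n + 1)) (Fin (n + 1)) ℝ :=
  Matrix.of fun i j =>
    if (j.val = 0 ∧ i.val = a.val) ∨ (j.val = n ∧ i.val ≤ 1) ∨
        (1 ≤ j.val ∧ j.val < n ∧ i.val = j.val + 1) then 1 else 0

/-- `B_a` is `A_a` with the two entries `1` of the last column replaced by `1/2`. -/
def B (n : ℕ) (a : Fin 2) : Matrix (Fin (n + 1)) (Fin (n + 1)) ℝ :=
  Matrix.of fun i j => if j.val = n then A n a i j / 2 else A n a i j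

/-- `D_a = V B_a V⁻¹`. -/
def D (n : ℕ) (a : Fin 2) : Matrix (Fin (n + 1)) (Fin (n + 1)) ℝ :=
  V n * B n a * (V n)⁻¹

/-- The column `(α_1, …, α_n, 1)` of projective coordinates of a point. -/
def proj {n : ℕ} (α : Fin n → ℝ) : Fin (n + 1) → ℝ :=
  Fin.snoc (α := fun _ => ℝ) α 1

/-- The affine map `τ_a` determined by `D_a`
(the last entry of `D_a (α_1, …, α_n, 1)` is always `1`). -/
def tau (n : ℕ) (a : Fin 2) (α : Fin n → ℝ) : Fin n → ℝ :=
  fun i => (D n a).mulVec (proj α) i.castSucc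

/-- The vertex `v_i` of the simplex, `0 ≤ i ≤ n`, in affine coordinates. -/
def vertex (n : ℕ) (i : Fin (n + 1)) : Fin n → ℝ :=
  fun r => V n r.castSucc i

/-- `Γ^o`: the points of the simplex whose barycentric coordinate `x_0` is positive. -/
def GamO (n : ℕ) : Set (Fin n → ℝ) :=
  {p | ∃ x : Fin (n + 1) → ℝ, (∀ i, 0 ≤ x i) ∧ ∑ i, x i = 1 ∧ 0 < x 0 ∧
    p = ∑ i, x i • vertex n i}

/-- `p` is the point `v_{-1}`: it lies in the simplex, and its projective coordinates are an
eigenvector of `D_1`. -/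
def IsVNegOne (n : ℕ) (p : Fin n → ℝ) : Prop :=
  p ∈ Gam n ∧ ∃ μ : ℝ, (D n 1).mulVec (proj p) = μ • proj p

/-- The map `τ_a^k ∘ τ_b`. -/
def tauPow (n : ℕ) (a b : Fin 2) (k : ℕ) : (Fin n → ℝ) → (Fin n → ℝ) :=
  (tau n a)^[k] ∘ tau n b

open Classical in
/-- The Kakutani-von Neumann transformation: `K v_{-1} = v_0`, and
`K = τ_0^k τ_1 (τ_1^k τ_0)⁻¹` on `τ_1^k τ_0 Γ^o` for every `k ≥ 0`. The point `v_{-1}` and the sets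
`τ_1^k τ_0 Γ^o` partition the simplex, so that the last branch is not used on it. -/
def K (n : ℕ) (p : Fin n → ℝ) : Fin n → ℝ :=
  if IsVNegOne n p then vertex n 0
  else if h : ∃ k : ℕ, p ∈ tauPow n 1 0 k '' GamO n then
    tauPow n 0 1 h.choose (Function.invFunOn (tauPow n 1 0 h.choose) (GamO n) p)
  else p

/-- `p` and `q` lie on one (two-sided) orbit of `K`, which is a bijection of the simplex:
`q = K^m p` for some integer `m`, negative powers being spelled out as `p = K^{-m} q`. -/
def SameKOrbit (n : ℕ) (p q : Fin n → ℝ) : Prop :=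
  ∃ m : ℕ, (K n)^[m] p = q ∨ (K n)^[m] q = p

/-- The `n`-dimensional tent map; `⊤` is the last index of `Fin n`. -/
def tent (n : ℕ) [NeZero n] (α : Fin n → ℝ) : Fin n → ℝ :=
  fun i =>
    if i.val = 0 then
      if α 0 + α ⊤ ≤ 1 then α 0 + α ⊤ else 2 - α 0 - α ⊤
    else α ⟨i.val - 1, lt_of_le_of_lt (Nat.sub_le _ _) i.isLt⟩ - α ⊤

/-- The composition `τ_{a_0} τ_{a_1} ⋯ τ_{a_{t-1}}`. -/
def tauWord (n : ℕ) (a : ℕ → Fin 2) : ℕ → (Fin n → ℝ) → (Fin n → ℝ)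
  | 0 => id
  | t + 1 => tauWord n a t ∘ tau n (a t)

/-- The simplex `Γ_{a_0 … a_{t-1}}`. -/
def GamWord (n : ℕ) (a : ℕ → Fin 2) (t : ℕ) : Set (Fin n → ℝ) :=
  tauWord n a t '' Gam n

/-- The simplex `Γ_a`, for a single symbol `a`. -/
def GamSym (n : ℕ) (a : Fin 2) : Set (Fin n → ℝ) := tau n a '' Gam n

/-- `a` is a symbolic orbit of `p`: the point `p` is the unique one in all the simplexes
`Γ_{a_0 … a_{t-1}}`, `t ≥ 0`. -/
def IsSymbolicOrbit (n : ℕ) (p : Fin n → ℝ) (a : ℕ → Fin 2) : Prop :=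
  ⋂ t : ℕ, GamWord n a t = {p}

/-- `a` is the final orbit of `p`: a symbolic orbit with `a_t = 1` whenever `T^t p ∈ Γ_0 ∩ Γ_1`. -/
def IsFinalOrbit (n : ℕ) [NeZero n] (p : Fin n → ℝ) (a : ℕ → Fin 2) : Prop :=
  IsSymbolicOrbit n p a ∧ ∀ t : ℕ, (tent n)^[t] p ∈ GamSym n 0 ∩ GamSym n 1 → a t = 1

/-- `c` is the `*`-orbit of `p`; the symbol `*` is `none`. -/
def IsStarOrbit (n : ℕ) [NeZero n] (p : Fin n → ℝ) (c : ℕ → Option (Fin 2)) : Prop :=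
  ∀ t : ℕ,
    ((tent n)^[t] p ∈ GamSym n 0 \ GamSym n 1 ∧ c t = some 0) ∨
    ((tent n)^[t] p ∈ GamSym n 1 \ GamSym n 0 ∧ c t = some 1) ∨
    ((tent n)^[t] p ∈ GamSym n 0 ∩ GamSym n 1 ∧ c t = none)

/-- Two sequences have the same tail. -/
def SameTail {X : Type} (a b : ℕ → X) : Prop := ∃ t : ℕ, ∀ r, t ≤ r → a r = b r

/-- The sequence `a` has tail `x x x …`. -/
def HasConstTail {X : Type} (a : ℕ → X) (x : X) : Prop := SameTail a fun _ => x

/-- The sequences `a` and `b` have the same tail, or one of them has tail `zero^∞` and the other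
has tail `one^∞`. -/
def TailRelated {X : Type} (zero one : X) (a b : ℕ → X) : Prop :=
  SameTail a b ∨ (HasConstTail a zero ∧ HasConstTail b one) ∨
    (HasConstTail a one ∧ HasConstTail b zero)

end KakutaniTent

end

noncomputable section

namespace KakutaniTent

open Matrix

/-! In barycentric coordinates the tent map is a queue: the first two entries `x 0`, `x 1` are
removed, `|x 0 - x 1|` is put in front and `2 * min (x 0) (x 1)` at the end. Whether a point is in
`Γ_0` or `Γ_1` depends on which of the two entries is larger (`bary_tent`, `mem_GamSym_iff`).

Symbolic orbits are exactly itineraries, because an itinerary determines its point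
(`eq_of_same_itinerary`). The difference of two points with one itinerary has sum zero and a bounded
orbit under a linear cocycle that never decreases the `ℓ¹` norm. On the compact set of all such data
take the norm maximal, then the number of nonzero entries minimal. There, a nonzero head keeps its
sign and all entries share it, contradicting sum zero; so all heads vanish, and with them the whole
queue.

All itineraries of a point have one tail (`IsItinerary.sameTail`). Indeed the number of nonzero
barycentric coordinates never grows and drops when two equal nonzero heads cancel, so the orbit ends
up in `Γ^o`, away from `Γ_0 ∩ Γ_1`. This makes final, arbitrary symbolic and `*`-orbits
interchangeable.

Finally, `K` acts as an odometer. It changes a prefix `1^k 0` into `0^k 1` without altering `T^(k+1)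
p`, except for the jump from `1^∞` to `0^∞` at `v_{-1}`. Conversely, all `t`-step preimages of a
point lie in one `K`-orbit (`sameKOrbit_tauWord`). -/

/-! ### Barycentric coordinates. -/

/-- The coordinates of a point, extended by `0`. -/
def extend {m : ℕ} (p : Fin (m + 1) → ℝ) (k : ℕ) : ℝ := if h : k < m + 1 then p ⟨k, h⟩ else 0

/-- Barycentric coordinates with respect to the vertices of the simplex. -/
def bary {n : ℕ} (p : Fin n → ℝ) : Fin (n + 1) → ℝ := (V n)⁻¹ *ᵥ proj p

/-- The explicit form of `V⁻¹`. -/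
def unV {m : ℕ} (y : Fin (m + 2) → ℝ) : Fin (m + 2) → ℝ :=
  Fin.cons (y (Fin.last _) - y 0) fun i : Fin (m + 1) =>
    y ⟨m - i, by omega⟩ - if i.val = 0 then 0 else y ⟨m - i + 1, by omega⟩

/-- Apart from the last row, consecutive rows of `V` differ in a single column, so differences of
the coordinates of `V *ᵥ x` isolate the entries of `x`. -/
theorem unV_V {m : ℕ} (x : Fin (m + 2) → ℝ) : unV (V (m + 1) *ᵥ x) = x := by
  funext j
  refine Fin.cases ?_ (fun i => ?_) j
  · simp only [unV, Fin.cons_zero, mulVec, dotProduct, ← Finset.sum_sub_distrib]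
    rw [Finset.sum_eq_single 0]
    · simp [V]
    · intro b _ hb
      have : 1 ≤ b.val := Nat.one_le_iff_ne_zero.2 (fun h => hb (Fin.ext h))
      have hb' := b.isLt
      simp [V, this, show b.val ≤ m + 1 by omega]
    · simp
  · simp only [unV, Fin.cons_succ, mulVec, dotProduct]
    have hi := i.isLt
    by_cases h : i.val = 0
    · rw [if_pos h, sub_zero, Finset.sum_eq_single i.succ]
      · simp [V, h]
      · intro b _ hb
        have : b.val ≠ 1 := fun h' => hb (Fin.ext (by simp [h, h']))
        have hn : ¬ (m - i.val = m + 1 ∨ 1 ≤ b.val ∧ m - i.val + b.val ≤ m + 1) := by omega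
        simp only [V, of_apply, if_neg hn, zero_mul]
      · simp
    · rw [if_neg h, ← Finset.sum_sub_distrib, Finset.sum_eq_single i.succ]
      · have h1 : m - i.val = m + 1 ∨ 1 ≤ i.succ.val ∧ m - i.val + i.succ.val ≤ m + 1 := by
          simp only [Fin.val_succ]; omega
        have h2 : ¬ (m - i.val + 1 = m + 1 ∨
            1 ≤ i.succ.val ∧ m - i.val + 1 + i.succ.val ≤ m + 1) := by
          simp only [Fin.val_succ]; omega
        simp only [V, of_apply, if_pos h1, if_neg h2]; ring
      · intro b _ hb
        have hb : b.val ≠ i.val + 1 := fun h' => hb (Fin.ext (by simp [h']))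
        have : (m - i.val = m + 1 ∨ 1 ≤ b.val ∧ m - i.val + b.val ≤ m + 1) ↔
            (m - i.val + 1 = m + 1 ∨ 1 ≤ b.val ∧ m - i.val + 1 + b.val ≤ m + 1) := by omega
        simp only [V, of_apply, this, sub_self]
      · simp

theorem isUnit_V (n : ℕ) [NeZero n] : IsUnit (V n).det := by
  obtain ⟨m, rfl⟩ := Nat.exists_eq_succ_of_ne_zero (NeZero.ne n)
  rw [← isUnit_iff_isUnit_det, ← mulVec_injective_iff_isUnit]
  exact Function.LeftInverse.injective unV_V

theorem V_bary {n : ℕ} [NeZero n] (p : Fin n → ℝ) : V n *ᵥ bary p = proj p := by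
  rw [bary, mulVec_mulVec, mul_nonsing_inv _ (isUnit_V n), one_mulVec]

theorem bary_of_V {n : ℕ} [NeZero n] {p : Fin n → ℝ} {x : Fin (n + 1) → ℝ}
    (h : V n *ᵥ x = proj p) : bary p = x := by
  rw [bary, ← h, mulVec_mulVec, nonsing_inv_mul _ (isUnit_V n), one_mulVec]

theorem proj_injective {n : ℕ} {p q : Fin n → ℝ} (h : proj p = proj q) : p = q := by
  funext i
  simpa [proj] using congrFun h i.castSucc

theorem bary_injective {n : ℕ} [NeZero n] {p q : Fin n → ℝ} (h : bary p = bary q) : p = q :=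
  proj_injective (by rw [← V_bary p, ← V_bary q, h])

theorem V_mulVec_last {n : ℕ} (x : Fin (n + 1) → ℝ) : (V n *ᵥ x) (Fin.last n) = ∑ i, x i := by
  simp [V, mulVec, dotProduct]

theorem sum_bary {n : ℕ} [NeZero n] (p : Fin n → ℝ) : ∑ i, bary p i = 1 := by
  rw [← V_mulVec_last, V_bary]; simp [proj]

theorem bary_eq {m : ℕ} (p : Fin (m + 1) → ℝ) :
    bary p = Fin.cons (1 - extend p 0)
      fun i : Fin (m + 1) => extend p (m - i) - extend p (m - i + 1) := by
  rw [← unV_V (bary p), V_bary]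
  funext j
  have hc : ∀ (k : ℕ) (h : k < m + 2) (h' : k < m + 1), proj p ⟨k, h⟩ = extend p k := by
    intro k h h'
    rw [extend, dif_pos h']
    exact Fin.snoc_castSucc (α := fun _ => ℝ) 1 p ⟨k, h'⟩
  refine Fin.cases ?_ (fun i => ?_) j
  · simp only [unV, Fin.cons_zero]
    rw [← hc 0 (by omega) (by omega)]
    simp [proj]
  · simp only [unV, Fin.cons_succ]
    rw [hc _ _ (by omega)]
    -- For `i = 0` the subtracted term is the coordinate just past the end, which `extend` sets to
    -- `0`.
    by_cases h : i.val = 0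
    · simp [h, extend]
    · have := i.isLt
      rw [if_neg h, hc _ _ (by omega)]

/-! ### The tent map as a queue. -/

/-- The queue operation: drop the first two entries, put `s` in front and `u` at the end. -/
def shift {m : ℕ} (s u : ℝ) (x : Fin (m + 2) → ℝ) : Fin (m + 2) → ℝ :=
  Fin.cons s (Fin.snoc (α := fun _ => ℝ) (fun i : Fin m => x i.succ.succ) u)

@[simp] theorem shift_zero {m : ℕ} (s u : ℝ) (x : Fin (m + 2) → ℝ) : shift s u x 0 = s := rfl

@[simp] theorem shift_last {m : ℕ} (s u : ℝ) (x : Fin (m + 2) → ℝ) :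
    shift s u x (Fin.last m).succ = u := by simp [shift, -Fin.succ_last]

@[simp] theorem shift_mid {m : ℕ} (s u : ℝ) (x : Fin (m + 2) → ℝ) (i : Fin m) :
    shift s u x i.castSucc.succ = x i.succ.succ := by simp [shift]

theorem ext_queue {m : ℕ} {x y : Fin (m + 2) → ℝ} (h0 : x 0 = y 0)
    (hl : x (Fin.last m).succ = y (Fin.last m).succ)
    (hm : ∀ i : Fin m, x i.castSucc.succ = y i.castSucc.succ) : x = y := by
  funext j
  refine Fin.cases h0 (fun i => ?_) j
  exact Fin.lastCases hl hm i

theorem sum_shift {m : ℕ} {M : Type*} [AddCommMonoid M] (f : ℝ → M) (s u : ℝ)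
    (x : Fin (m + 2) → ℝ) :
    ∑ i, f (shift s u x i) = f s + f u + ∑ i : Fin m, f (x i.succ.succ) := by
  rw [Fin.sum_univ_succ, Fin.sum_univ_castSucc]
  simp only [shift_zero, shift_mid, shift_last]
  rw [add_assoc, add_comm (f u)]

theorem sum_queue {m : ℕ} {M : Type*} [AddCommMonoid M] (f : ℝ → M) (x : Fin (m + 2) → ℝ) :
    ∑ i, f (x i) = f (x 0) + f (x 1) + ∑ i : Fin m, f (x i.succ.succ) := by
  rw [Fin.sum_univ_succ, Fin.sum_univ_succ, ← add_assoc]; rfl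

/-- Since `α_1 = 1 - x_0` and `α_n = x_1`, the condition `α_1 + α_n ≤ 1` reads `x_1 ≤ x_0`; the
absolute value and the minimum absorb the two cases. -/
theorem bary_tent {m : ℕ} (p : Fin (m + 1) → ℝ) :
    bary (tent (m + 1) p) =
      shift |bary p 0 - bary p 1| (2 * min (bary p 0) (bary p 1)) (bary p) := by
  have h0 : bary p 0 = 1 - extend p 0 := by rw [bary_eq]; rfl
  have hs : ∀ i : Fin (m + 1), bary p i.succ = extend p (m - i) - extend p (m - i + 1) :=
    fun i => by rw [bary_eq]; rfl
  have h1 : bary p 1 = extend p m := by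
    refine (hs 0).trans ?_
    simp [extend]
  have hT0 : extend (tent (m + 1) p) 0 =
      if extend p 0 + extend p m ≤ 1 then extend p 0 + extend p m
      else 2 - extend p 0 - extend p m := by
    simp [extend, tent, Fin.top_eq_last, Fin.last]
    rfl
  have hTs : ∀ k, k ≤ m → extend (tent (m + 1) p) (k + 1) = extend p k - extend p m := by
    intro k hk
    rcases hk.lt_or_eq with h | rfl
    · simp [extend, tent, Fin.top_eq_last, Fin.last, h, Nat.lt_succ_of_lt h]
    · simp [extend]
  have hm : ∀ i : Fin m, m - i.val = (m - (i.val + 1)) + 1 := fun i => by omega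
  rw [bary_eq (tent (m + 1) p)]
  refine ext_queue ?_ ?_ fun i => ?_
  · rw [Fin.cons_zero, shift_zero, hT0, h0, h1]
    split_ifs with h
    · rw [abs_of_nonneg] <;> linarith
    · rw [abs_of_nonpos] <;> linarith
  · rw [Fin.cons_succ, shift_last, Fin.val_last, Nat.sub_self, hTs 0 (Nat.zero_le _), hT0, h0, h1]
    split_ifs with h
    · rw [min_eq_right] <;> linarith
    · rw [min_eq_left] <;> linarith
  · rw [Fin.cons_succ, shift_mid, hs, Fin.val_castSucc, Fin.val_succ, hTs _ (by omega), hm i,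
      hTs _ (by omega)]
    ring

theorem mem_Gam_iff {n : ℕ} [NeZero n] {p : Fin n → ℝ} : p ∈ Gam n ↔ ∀ i, 0 ≤ bary p i := by
  obtain ⟨m, rfl⟩ := Nat.exists_eq_succ_of_ne_zero (NeZero.ne n)
  have he : ∀ i : Fin (m + 1), p i = extend p i := fun i => by
    rw [extend, dif_pos i.isLt]
  rw [bary_eq]
  constructor
  · rintro ⟨h0, h1, ha⟩ j
    refine Fin.cases ?_ (fun i => ?_) j
    · simpa [extend] using h1 0
    · rw [Fin.cons_succ, sub_nonneg]
      have hi : m - i.val < m + 1 := by omega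
      by_cases h : m - i.val + 1 < m + 1
      · simp only [extend, dif_pos h, dif_pos hi]
        exact ha _ _ (Fin.mk_le_mk.2 (Nat.le_succ _))
      · simp only [extend, dif_neg h, dif_pos hi]
        exact h0 _
  · intro h
    have h0 : extend p 0 ≤ 1 := sub_nonneg.1 (h 0)
    have hanti : Antitone (extend p) := by
      refine antitone_nat_of_succ_le fun k => ?_
      by_cases hk : k < m + 1
      · have := sub_nonneg.1 (h (Fin.succ ⟨m - k, by omega⟩))
        simpa [Nat.sub_sub_self (Nat.le_of_lt_succ hk)] using this
      · have hk' : ¬ k + 1 < m + 1 := by omega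
        rw [extend, dif_neg hk', extend, dif_neg hk]
    refine ⟨fun i => ?_, fun i => ?_, fun i j hij => ?_⟩
    · rw [he]
      exact (show extend p (m + 1) = 0 by simp [extend]) ▸ hanti i.isLt.le
    · rw [he]
      exact (hanti (Nat.zero_le _)).trans h0
    · rw [he, he]
      exact hanti hij

/-! ### The inverse branches in barycentric coordinates. -/

theorem B_mulVec_zero {m : ℕ} (a : Fin 2) (x : Fin (m + 2) → ℝ) :
    (B (m + 1) a *ᵥ x) 0 = (if a = 0 then x 0 else 0) + x (Fin.last m).succ / 2 := by
  simp only [mulVec, dotProduct]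
  rw [Fin.sum_univ_succ, Fin.sum_univ_castSucc]
  fin_cases a <;> simp [B, A, -Fin.succ_last, div_eq_inv_mul]
  all_goals exact Finset.sum_eq_zero fun i _ => by simp [i.isLt.ne]

theorem B_mulVec_one {m : ℕ} (a : Fin 2) (x : Fin (m + 2) → ℝ) :
    (B (m + 1) a *ᵥ x) 1 = (if a = 0 then 0 else x 0) + x (Fin.last m).succ / 2 := by
  simp only [mulVec, dotProduct]
  rw [Fin.sum_univ_succ, Fin.sum_univ_castSucc]
  fin_cases a <;> simp [B, A, -Fin.succ_last, div_eq_inv_mul]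
  all_goals exact Finset.sum_eq_zero fun i _ => by simp [i.isLt.ne]

theorem B_mulVec_succ_succ {m : ℕ} (a : Fin 2) (x : Fin (m + 2) → ℝ) (i : Fin m) :
    (B (m + 1) a *ᵥ x) i.succ.succ = x i.castSucc.succ := by
  simp only [mulVec, dotProduct]
  rw [Finset.sum_eq_single i.castSucc.succ]
  · have := i.isLt
    simp [B, A, i.isLt.ne]
  · intro b _ hb
    have hb' : b.val ≠ i.val + 1 := fun h => hb (Fin.ext (by simp [h]))
    have ha := a.isLt
    have : ¬ ((b.val = 0 ∧ i.val + 1 + 1 = a.val) ∨ (b.val = m + 1 ∧ i.val + 1 + 1 ≤ 1) ∨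
        (1 ≤ b.val ∧ b.val < m + 1 ∧ i.val + 1 + 1 = b.val + 1)) := by omega
    simp only [B, A, of_apply, Fin.val_succ, if_neg this]
    simp
  · simp

/-- The columns of `B` sum to `1`. This is why `D` keeps the last projective coordinate equal to
`1`. -/
theorem sum_B_mulVec {m : ℕ} (a : Fin 2) (x : Fin (m + 2) → ℝ) :
    ∑ i, (B (m + 1) a *ᵥ x) i = ∑ i, x i := by
  rw [sum_queue (fun y => y), Fin.sum_univ_succ (f := x), Fin.sum_univ_castSucc]
  simp only [B_mulVec_zero, B_mulVec_one, B_mulVec_succ_succ]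
  split_ifs <;> ring

theorem proj_tau {n : ℕ} [NeZero n] (a : Fin 2) (p : Fin n → ℝ) :
    proj (tau n a p) = D n a *ᵥ proj p := by
  have hD : D n a *ᵥ proj p = V n *ᵥ (B n a *ᵥ bary p) := by
    simp only [D, bary, mulVec_mulVec, Matrix.mul_assoc]
  funext i
  refine Fin.lastCases ?_ (fun i => ?_) i
  · rw [hD, V_mulVec_last]
    obtain ⟨m, rfl⟩ := Nat.exists_eq_succ_of_ne_zero (NeZero.ne n)
    rw [sum_B_mulVec, sum_bary]
    simp [proj]
  · simp [proj, tau]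

theorem bary_tau {n : ℕ} [NeZero n] (a : Fin 2) (p : Fin n → ℝ) :
    bary (tau n a p) = B n a *ᵥ bary p := by
  refine bary_of_V ?_
  rw [proj_tau]
  simp only [D, bary, mulVec_mulVec, Matrix.mul_assoc]

theorem sum_smul_vertex {n : ℕ} (x : Fin (n + 1) → ℝ) (r : Fin n) :
    (∑ i, x i • vertex n i) r = (V n *ᵥ x) r.castSucc := by
  simp [vertex, mulVec, dotProduct, mul_comm]

theorem mem_GamO_iff {n : ℕ} [NeZero n] {p : Fin n → ℝ} :
    p ∈ GamO n ↔ p ∈ Gam n ∧ 0 < bary p 0 := by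
  rw [mem_Gam_iff]
  constructor
  · rintro ⟨x, hx, hs, h0, rfl⟩
    have : bary (∑ i, x i • vertex n i) = x := by
      refine bary_of_V ?_
      funext i
      refine Fin.lastCases ?_ (fun i => ?_) i
      · rw [V_mulVec_last, hs]; simp [proj]
      · rw [← sum_smul_vertex]; simp [proj]
    rw [this]
    exact ⟨hx, h0⟩
  · rintro ⟨h, h0⟩
    refine ⟨bary p, h, sum_bary p, h0, ?_⟩
    funext r
    rw [sum_smul_vertex, V_bary]
    simp [proj]

theorem bary_tau_zero {m : ℕ} (a : Fin 2) (p : Fin (m + 1) → ℝ) :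
    bary (tau (m + 1) a p) 0 =
      (if a = 0 then bary p 0 else 0) + bary p (Fin.last m).succ / 2 := by
  rw [bary_tau, B_mulVec_zero]

theorem bary_tau_one {m : ℕ} (a : Fin 2) (p : Fin (m + 1) → ℝ) :
    bary (tau (m + 1) a p) 1 =
      (if a = 0 then 0 else bary p 0) + bary p (Fin.last m).succ / 2 := by
  rw [bary_tau, B_mulVec_one]

theorem bary_tau_succ_succ {m : ℕ} (a : Fin 2) (p : Fin (m + 1) → ℝ) (i : Fin m) :
    bary (tau (m + 1) a p) i.succ.succ = bary p i.castSucc.succ := by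
  rw [bary_tau, B_mulVec_succ_succ]

theorem ext_front {m : ℕ} {x y : Fin (m + 2) → ℝ} (h0 : x 0 = y 0) (h1 : x 1 = y 1)
    (hm : ∀ i : Fin m, x i.succ.succ = y i.succ.succ) : x = y := by
  funext j
  refine Fin.cases h0 (fun i => ?_) j
  exact Fin.cases h1 hm i

theorem tau_mem {n : ℕ} [NeZero n] (a : Fin 2) {p : Fin n → ℝ} (hp : p ∈ Gam n) :
    tau n a p ∈ Gam n := by
  obtain ⟨m, rfl⟩ := Nat.exists_eq_succ_of_ne_zero (NeZero.ne n)
  rw [mem_Gam_iff] at hp ⊢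
  intro j
  refine Fin.cases ?_ (fun j => Fin.cases ?_ (fun i => ?_) j) j
  · rw [bary_tau_zero]
    have := hp 0
    have := hp (Fin.last m).succ
    split_ifs <;> positivity
  · refine le_of_le_of_eq ?_ (bary_tau_one a p).symm
    have := hp 0
    have := hp (Fin.last m).succ
    split_ifs <;> positivity
  · rw [bary_tau_succ_succ]; exact hp _

theorem tent_tau {n : ℕ} [NeZero n] (a : Fin 2) {p : Fin n → ℝ} (hp : p ∈ Gam n) :
    tent n (tau n a p) = p := by
  obtain ⟨m, rfl⟩ := Nat.exists_eq_succ_of_ne_zero (NeZero.ne n)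
  rw [mem_Gam_iff] at hp
  have h0 := hp 0
  apply bary_injective
  rw [bary_tent]
  refine ext_queue ?_ ?_ fun i => ?_
  · rw [shift_zero, bary_tau_zero, bary_tau_one]
    split_ifs
    · rw [abs_of_nonneg] <;> linarith
    · rw [abs_of_nonpos] <;> linarith
  · rw [shift_last, bary_tau_zero, bary_tau_one]
    split_ifs
    · rw [min_eq_right] <;> linarith
    · rw [min_eq_left] <;> linarith
  · rw [shift_mid, bary_tau_succ_succ]

theorem tau_injOn {n : ℕ} [NeZero n] (a : Fin 2) : Set.InjOn (tau n a) (Gam n) :=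
  fun _ hp _ hq h => by rw [← tent_tau a hp, h, tent_tau a hq]

/-- Membership in `Γ_a` is decided by the first two barycentric coordinates. -/
theorem mem_GamSym_iff {n : ℕ} [NeZero n] {a : Fin 2} {p : Fin n → ℝ} :
    p ∈ GamSym n a ↔
      p ∈ Gam n ∧ if a = 0 then bary p 1 ≤ bary p 0 else bary p 0 ≤ bary p 1 := by
  obtain ⟨m, rfl⟩ := Nat.exists_eq_succ_of_ne_zero (NeZero.ne n)
  constructor
  · rintro ⟨y, hy, rfl⟩
    refine ⟨tau_mem a hy, ?_⟩
    have h0 := mem_Gam_iff.1 hy 0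
    rw [bary_tau_zero, bary_tau_one]
    split_ifs <;> linarith
  · rintro ⟨hp, h⟩
    have hp' := mem_Gam_iff.1 hp
    refine ⟨tent (m + 1) p, ?_, ?_⟩
    · rw [mem_Gam_iff, bary_tent]
      intro j
      refine Fin.cases ?_ (fun j => Fin.lastCases ?_ (fun i => ?_) j) j
      · exact abs_nonneg _
      · rw [shift_last]
        exact mul_nonneg zero_le_two (le_min (hp' 0) (hp' 1))
      · rw [shift_mid]; exact hp' _
    · apply bary_injective
      refine ext_front ?_ ?_ fun i => ?_
      · rw [bary_tau_zero, bary_tent, shift_zero, shift_last]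
        split_ifs at h ⊢
        · rw [abs_of_nonneg, min_eq_right] <;> linarith
        · rw [min_eq_left] <;> linarith
      · rw [bary_tau_one, bary_tent, shift_zero, shift_last]
        split_ifs at h ⊢
        · rw [min_eq_right] <;> linarith
        · rw [abs_of_nonpos, min_eq_left] <;> linarith
      · rw [bary_tau_succ_succ, bary_tent, shift_mid]

theorem GamSym_subset {n : ℕ} [NeZero n] {a : Fin 2} {p : Fin n → ℝ} (h : p ∈ GamSym n a) :
    p ∈ Gam n := (mem_GamSym_iff.1 h).1

theorem mem_GamSym_or {n : ℕ} [NeZero n] {p : Fin n → ℝ} (hp : p ∈ Gam n) :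
    p ∈ GamSym n 0 ∨ p ∈ GamSym n 1 := by
  simp only [mem_GamSym_iff]
  rcases le_total (bary p 1) (bary p 0) with h | h
  · exact Or.inl ⟨hp, by simpa using h⟩
  · exact Or.inr ⟨hp, by simpa using h⟩

theorem tent_mem_of_mem_GamSym {n : ℕ} [NeZero n] {a : Fin 2} {p : Fin n → ℝ}
    (hp : p ∈ GamSym n a) : tent n p ∈ Gam n := by
  obtain ⟨y, hy, rfl⟩ := hp
  rwa [tent_tau a hy]

theorem tau_tent {n : ℕ} [NeZero n] {a : Fin 2} {p : Fin n → ℝ} (hp : p ∈ GamSym n a) :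
    tau n a (tent n p) = p := by
  obtain ⟨y, hy, rfl⟩ := hp
  rw [tent_tau a hy]

theorem tent_mem {n : ℕ} [NeZero n] {p : Fin n → ℝ} (hp : p ∈ Gam n) : tent n p ∈ Gam n :=
  (mem_GamSym_or hp).elim tent_mem_of_mem_GamSym tent_mem_of_mem_GamSym

theorem GamO_subset {n : ℕ} [NeZero n] {p : Fin n → ℝ} (h : p ∈ GamO n) : p ∈ Gam n :=
  (mem_GamO_iff.1 h).1

/-- The two branches differ only in where they put the head `x_0`, which is zero off `Γ^o`. -/
theorem tau_eq_of_notMem_GamO {n : ℕ} [NeZero n] {p : Fin n → ℝ} (hp : p ∈ Gam n)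
    (h : p ∉ GamO n) (a b : Fin 2) : tau n a p = tau n b p := by
  obtain ⟨m, rfl⟩ := Nat.exists_eq_succ_of_ne_zero (NeZero.ne n)
  have h0 : bary p 0 = 0 :=
    le_antisymm (not_lt.1 fun h' => h (mem_GamO_iff.2 ⟨hp, h'⟩)) (mem_Gam_iff.1 hp 0)
  apply bary_injective
  refine ext_front ?_ ?_ fun i => ?_
  · simp [bary_tau_zero, h0]
  · simp [bary_tau_one, h0]
  · simp [bary_tau_succ_succ]

/-- The first two entries of the image differ by exactly `x_0 > 0`, with the larger one decided by
`a`. -/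
theorem tau_notMem_GamSym {n : ℕ} [NeZero n] {p : Fin n → ℝ} (h : p ∈ GamO n) {a b : Fin 2}
    (hab : a ≠ b) : tau n a p ∉ GamSym n b := by
  obtain ⟨m, rfl⟩ := Nat.exists_eq_succ_of_ne_zero (NeZero.ne n)
  have h0 := (mem_GamO_iff.1 h).2
  rw [mem_GamSym_iff, bary_tau_zero, bary_tau_one]
  rintro ⟨-, h'⟩
  fin_cases a <;> fin_cases b <;> simp at hab h' <;> linarith

/-- The last projective coordinate is preserved, so the eigenvalue can only be `1`. -/
theorem isVNegOne_iff {n : ℕ} [NeZero n] {p : Fin n → ℝ} :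
    IsVNegOne n p ↔ p ∈ Gam n ∧ tau n 1 p = p := by
  refine and_congr_right fun _ => ?_
  rw [← Function.Injective.eq_iff (f := proj) fun _ _ => proj_injective, proj_tau]
  constructor
  · rintro ⟨μ, h⟩
    have := congrFun h (Fin.last n)
    rw [← proj_tau] at this
    have hμ : 1 = μ := by simpa [proj] using this
    rw [h, ← hμ, one_smul]
  · intro h
    exact ⟨1, by rw [h, one_smul]⟩

theorem vertex_zero (n : ℕ) : vertex n 0 = 0 := by
  funext r
  simp [vertex, V, r.isLt.ne]

theorem vertex_zero_mem_GamO (n : ℕ) [NeZero n] : vertex n 0 ∈ GamO n := by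
  refine ⟨Pi.single 0 1, fun i => ?_, by simp, by simp, ?_⟩
  · rw [Pi.single_apply]; split_ifs <;> norm_num
  · simp [Pi.single_apply]

theorem tau_vertex_zero (n : ℕ) [NeZero n] : tau n 0 (vertex n 0) = vertex n 0 := by
  obtain ⟨m, rfl⟩ := Nat.exists_eq_succ_of_ne_zero (NeZero.ne n)
  have h : bary (vertex (m + 1) 0) = Fin.cons 1 0 := by
    rw [bary_eq, vertex_zero]
    funext j
    refine Fin.cases ?_ (fun i => ?_) j <;> simp [extend]
  apply bary_injective
  refine ext_front ?_ ?_ fun i => ?_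
  · rw [bary_tau_zero, h]; simp [-Fin.succ_last]
  · rw [bary_tau_one, h, ← Fin.succ_zero_eq_one]; simp [-Fin.succ_last, -Fin.succ_zero_eq_one]
  · rw [bary_tau_succ_succ, h]; simp

/-! ### The linear cocycle on differences of points. -/

/-- The linear part of the branch `a` of the tent map, in barycentric coordinates. -/
def lin {m : ℕ} (a : Fin 2) (d : Fin (m + 2) → ℝ) : Fin (m + 2) → ℝ :=
  if a = 0 then shift (d 0 - d 1) (2 * d 1) d else shift (d 1 - d 0) (2 * d 0) d

/-- The cocycle generated by `lin` along the sequence `a`. -/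
def linIter {m : ℕ} (a : ℕ → Fin 2) (d : Fin (m + 2) → ℝ) : ℕ → Fin (m + 2) → ℝ
  | 0 => d
  | t + 1 => lin (a t) (linIter a d t)

theorem linIter_succ' {m : ℕ} (a : ℕ → Fin 2) (d : Fin (m + 2) → ℝ) (t : ℕ) :
    linIter (fun s => a (s + 1)) (lin (a 0) d) t = linIter a d (t + 1) := by
  induction t with
  | zero => rfl
  | succ t ih => rw [linIter, ih]; rfl

theorem sum_lin {m : ℕ} (a : Fin 2) (d : Fin (m + 2) → ℝ) : ∑ i, lin a d i = ∑ i, d i := by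
  unfold lin
  split_ifs
  all_goals
    rw [sum_shift (fun y => y), sum_queue (fun y => y) d]
    ring

theorem lin_mid {m : ℕ} (a : Fin 2) (d : Fin (m + 2) → ℝ) (i : Fin m) :
    lin a d i.castSucc.succ = d i.succ.succ := by
  unfold lin
  split_ifs <;> exact shift_mid _ _ _ _

theorem lin_zero_eq_zero_iff {m : ℕ} (a : Fin 2) (d : Fin (m + 2) → ℝ) :
    lin a d 0 = 0 ↔ d 0 = d 1 := by
  unfold lin
  split_ifs
  · rw [shift_zero, sub_eq_zero]
  · rw [shift_zero, sub_eq_zero, eq_comm]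

theorem bary_tent_sub {m : ℕ} {a : Fin 2} {p q : Fin (m + 1) → ℝ}
    (hp : p ∈ GamSym (m + 1) a) (hq : q ∈ GamSym (m + 1) a) :
    bary (tent (m + 1) p) - bary (tent (m + 1) q) = lin a (bary p - bary q) := by
  have hp := (mem_GamSym_iff.1 hp).2
  have hq := (mem_GamSym_iff.1 hq).2
  rw [bary_tent, bary_tent, lin]
  split_ifs at hp hq ⊢
  · rw [abs_of_nonneg (sub_nonneg.2 hp), abs_of_nonneg (sub_nonneg.2 hq), min_eq_right hp,
      min_eq_right hq]
    refine ext_queue ?_ ?_ fun i => ?_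
    · simp; ring
    · simp only [Pi.sub_apply, shift_last]; ring
    · simp only [Pi.sub_apply, shift_mid]
  · rw [abs_of_nonpos (sub_nonpos.2 hp), abs_of_nonpos (sub_nonpos.2 hq), min_eq_left hp,
      min_eq_left hq]
    refine ext_queue ?_ ?_ fun i => ?_
    · simp; ring
    · simp only [Pi.sub_apply, shift_last]; ring
    · simp only [Pi.sub_apply, shift_mid]

/-- The sum of the absolute values of the entries. -/
def absSum {m : ℕ} (d : Fin (m + 2) → ℝ) : ℝ := ∑ i, |d i|

open Classical in
/-- The number of nonzero entries. -/
def nonzeros {m : ℕ} (d : Fin (m + 2) → ℝ) : ℕ := ∑ i, if d i = 0 then 0 else 1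

theorem absSum_le_absSum_lin {m : ℕ} (a : Fin 2) (d : Fin (m + 2) → ℝ) :
    absSum d ≤ absSum (lin a d) := by
  unfold absSum lin
  split_ifs
  all_goals
    rw [sum_shift (fun y => |y|), sum_queue (fun y => |y|) d, abs_mul, abs_two]
  · have := abs_sub_abs_le_abs_sub (d 0) (d 1)
    linarith
  · have := abs_sub_abs_le_abs_sub (d 1) (d 0)
    linarith

/-- The norm can only grow through the triangle inequality for `d 0 = (d 0 - d 1) + d 1`, or its
mirror image; preserving the norm means equality there. -/
theorem head_of_absSum_lin_eq {m : ℕ} {a : Fin 2} {d : Fin (m + 2) → ℝ}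
    (h : absSum (lin a d) = absSum d) :
    if a = 0 then |d 0 - d 1| + |d 1| = |d 0| else |d 1 - d 0| + |d 0| = |d 1| := by
  unfold absSum lin at h
  split_ifs at h ⊢
  all_goals
    rw [sum_shift (fun y => |y|), sum_queue (fun y => |y|) d, abs_mul, abs_two] at h
    linarith

/-- Norm preservation excludes the only case that creates a nonzero entry: for `a = 0`, a pair `0,
y` with `y ≠ 0` would become `-y, 2 * y`. -/
theorem nonzeros_lin_le {m : ℕ} {a : Fin 2} {d : Fin (m + 2) → ℝ}
    (h : absSum (lin a d) = absSum d) :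
    nonzeros (lin a d) ≤ nonzeros d ∧
      (d 0 ≠ 0 → d 0 = d 1 → nonzeros (lin a d) < nonzeros d) := by
  have h := head_of_absSum_lin_eq h
  classical
  unfold nonzeros lin
  split_ifs at h ⊢
  all_goals
    rw [sum_shift (fun y => if y = 0 then 0 else 1), sum_queue (fun y => if y = 0 then 0 else 1) d]
  · by_cases h0 : d 0 = 0
    · have : d 1 = 0 := by
        rw [h0, abs_zero] at h
        exact abs_eq_zero.1 (le_antisymm (by linarith [abs_nonneg (0 - d 1)]) (abs_nonneg _))
      simp [h0, this]
    · refine ⟨?_, fun _ h1 => ?_⟩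
      · by_cases h1 : d 1 = 0 <;> simp [h0, h1]
        split_ifs <;> omega
      · rw [← h1]; simp [h0]
  · by_cases h1 : d 1 = 0
    · have : d 0 = 0 := by
        rw [h1, abs_zero] at h
        exact abs_eq_zero.1 (le_antisymm (by linarith [abs_nonneg (0 - d 0)]) (abs_nonneg _))
      simp [h1, this]
    · refine ⟨?_, fun _ h0 => ?_⟩
      · by_cases h0 : d 0 = 0 <;> simp [h0, h1]
        split_ifs <;> omega
      · rw [h0]; simp [h1]

/-- If the norm is preserved, then the new head has the sign of the old one. -/
theorem head_sign {m : ℕ} {a : Fin 2} {d : Fin (m + 2) → ℝ}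
    (h : absSum (lin a d) = absSum d) (h0 : d 0 ≠ 0) (h1 : d 0 ≠ d 1) :
    0 ≤ d 0 * d 1 ∧ 0 < d 0 * lin a d 0 := by
  -- Equality in the triangle inequality: the two summands cannot have opposite signs.
  have h := head_of_absSum_lin_eq h
  unfold lin
  split_ifs at h ⊢
  · rw [shift_zero]
    rcases lt_or_gt_of_ne h0 with h0 | h0 <;> rcases lt_or_gt_of_ne h1 with h1 | h1
    · rw [abs_of_neg (sub_neg.2 h1), abs_of_neg h0] at h
      have : d 1 ≤ 0 := abs_eq_neg_self.1 (by linarith)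
      exact ⟨mul_nonneg_of_nonpos_of_nonpos h0.le this, mul_pos_of_neg_of_neg h0 (by linarith)⟩
    · rw [abs_of_pos (sub_pos.2 h1), abs_of_neg h0, abs_of_neg (h1.trans h0)] at h
      linarith
    · rw [abs_of_neg (sub_neg.2 h1), abs_of_pos h0, abs_of_pos (h0.trans h1)] at h
      linarith
    · rw [abs_of_pos (sub_pos.2 h1), abs_of_pos h0] at h
      have : 0 ≤ d 1 := abs_eq_self.1 (by linarith)
      exact ⟨mul_nonneg h0.le this, mul_pos h0 (by linarith)⟩
  · rw [shift_zero]
    rcases lt_or_gt_of_ne h0 with h0 | h0 <;> rcases lt_or_gt_of_ne h1 with h1 | h1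
    · rw [abs_of_pos (sub_pos.2 h1), abs_of_neg h0] at h
      rcases abs_cases (d 1) with ⟨h2, h3⟩ | ⟨h2, h3⟩ <;> linarith
    · have : d 1 < 0 := h1.trans h0
      exact ⟨(mul_pos_of_neg_of_neg h0 this).le, mul_pos_of_neg_of_neg h0 (by linarith)⟩
    · have : 0 < d 1 := h0.trans h1
      exact ⟨(mul_pos h0 this).le, mul_pos h0 (by linarith)⟩
    · rw [abs_of_neg (sub_neg.2 h1), abs_of_pos h0] at h
      rcases abs_cases (d 1) with ⟨h2, h3⟩ | ⟨h2, h3⟩ <;> linarith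

/-- A queue all of whose heads vanish is zero. -/
theorem eq_zero_of_heads {m : ℕ} {X : Type*} (S : Set X) (d : X → Fin (m + 2) → ℝ) (f : X → X)
    (hf : ∀ z ∈ S, f z ∈ S) (h0 : ∀ z ∈ S, d z 0 = 0)
    (h1 : ∀ z ∈ S, d (f z) 0 = 0 → d z 0 = 0 → d z 1 = 0)
    (hm : ∀ z ∈ S, ∀ i : Fin m, d (f z) i.castSucc.succ = d z i.succ.succ)
    {z : X} (hz : z ∈ S) : d z = 0 := by
  -- Beyond the first two places, each entry is one place nearer the head after a step, so vanishing
  -- at one place on all of `S` passes to the next.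
  have key : ∀ k (hk : k < m + 2), ∀ z ∈ S, d z ⟨k, hk⟩ = 0 := by
    intro k
    induction k with
    | zero => exact fun _ => h0
    | succ k ih =>
      intro hk z hz
      rcases k with _ | k
      · exact h1 z hz (h0 _ (hf z hz)) (h0 z hz)
      · exact (hm z hz ⟨k, by omega⟩).symm.trans (ih (by omega) _ (hf z hz))
  funext i
  exact key i i.isLt z hz

/-! ### Bounded orbits vanish, and itineraries separate points. -/

/-- Vectors of sum zero together with a sequence along which their orbit is bounded. -/
def boundedOrbits (m : ℕ) : Set ((Fin (m + 2) → ℝ) × (ℕ → Fin 2)) :=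
  {z | ∑ i, z.1 i = 0 ∧ ∀ t i, |linIter z.2 z.1 t i| ≤ 1}

/-- One step of the cocycle, together with the shift of the sequence. -/
def skew {m : ℕ} (z : (Fin (m + 2) → ℝ) × (ℕ → Fin 2)) : (Fin (m + 2) → ℝ) × (ℕ → Fin 2) :=
  (lin (z.2 0) z.1, fun t => z.2 (t + 1))

theorem skew_mem {m : ℕ} {z : (Fin (m + 2) → ℝ) × (ℕ → Fin 2)} (hz : z ∈ boundedOrbits m) :
    skew z ∈ boundedOrbits m := by
  refine ⟨(sum_lin _ _).trans hz.1, fun t i => ?_⟩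
  have := hz.2 (t + 1) i
  rwa [← linIter_succ'] at this

theorem continuous_shift {m : ℕ} {X : Type*} [TopologicalSpace X] {s u : X → ℝ}
    {x : X → Fin (m + 2) → ℝ} (hs : Continuous s) (hu : Continuous u) (hx : Continuous x) :
    Continuous fun z => shift (s z) (u z) (x z) := by
  refine continuous_pi fun j => Fin.cases ?_ (fun j => Fin.lastCases ?_ (fun i => ?_) j) j
  · simpa using hs
  · simpa only [shift_last] using hu
  · simp only [shift_mid]
    exact (continuous_apply _).comp hx

theorem continuous_lin {m : ℕ} :
    Continuous fun z : Fin 2 × (Fin (m + 2) → ℝ) => lin z.1 z.2 := by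
  rw [continuous_prod_of_discrete_left]
  intro a
  unfold lin
  dsimp only
  split_ifs
  all_goals exact continuous_shift (by fun_prop) (by fun_prop) continuous_id

theorem continuous_linIter {m : ℕ} (t : ℕ) :
    Continuous fun z : (Fin (m + 2) → ℝ) × (ℕ → Fin 2) => linIter z.2 z.1 t := by
  induction t with
  | zero => exact continuous_fst
  | succ t ih => exact continuous_lin.comp (((continuous_apply t).comp continuous_snd).prodMk ih)

theorem isCompact_boundedOrbits (m : ℕ) : IsCompact (boundedOrbits m) := by
  have hc : IsCompact ((Set.univ.pi fun _ : Fin (m + 2) => Set.Icc (-1 : ℝ) 1) ×ˢ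
      (Set.univ : Set (ℕ → Fin 2))) :=
    (isCompact_univ_pi fun _ => isCompact_Icc).prod isCompact_univ
  refine hc.of_isClosed_subset ?_ fun z hz => ⟨fun i _ => abs_le.1 (hz.2 0 i), trivial⟩
  have h1 : IsClosed {z : (Fin (m + 2) → ℝ) × (ℕ → Fin 2) | ∑ i, z.1 i = 0} :=
    isClosed_eq (by fun_prop) continuous_const
  have h2 : ∀ t i, IsClosed {z : (Fin (m + 2) → ℝ) × (ℕ → Fin 2) | |linIter z.2 z.1 t i| ≤ 1} :=
    fun t i => isClosed_le ((continuous_apply i).comp (continuous_linIter t)).abs continuous_const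
  convert h1.inter (isClosed_iInter fun t => isClosed_iInter fun i => h2 t i) using 1
  ext z
  simp [boundedOrbits]

/-- Including the sequence in the data makes the set both compact and `skew`-invariant. At a norm
maximizer no step can increase the norm, so the equality cases apply along the whole orbit. -/
theorem eq_zero_of_mem_boundedOrbits {m : ℕ} {z : (Fin (m + 2) → ℝ) × (ℕ → Fin 2)}
    (hz : z ∈ boundedOrbits m) : z.1 = 0 := by
  have hcont : Continuous fun z : (Fin (m + 2) → ℝ) × (ℕ → Fin 2) => absSum z.1 := by
    unfold absSum; fun_prop
  obtain ⟨w, hw, hmax⟩ := (isCompact_boundedOrbits m).exists_isMaxOn ⟨z, hz⟩ hcont.continuousOn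
  have hmax : ∀ y ∈ boundedOrbits m, absSum y.1 ≤ absSum w.1 := hmax
  have eq_zero : ∀ d : Fin (m + 2) → ℝ, absSum d ≤ 0 → d = 0 := by
    intro d hd
    funext i
    have := Finset.single_le_sum (f := fun i => |d i|) (fun i _ => abs_nonneg _)
      (Finset.mem_univ i)
    exact abs_nonpos_iff.1 (this.trans hd)
  suffices h : absSum w.1 = 0 from eq_zero _ ((hmax z hz).trans h.le)
  let T := {y ∈ boundedOrbits m | absSum y.1 = absSum w.1}
  have hT : T.Nonempty := ⟨w, hw, rfl⟩
  have absSum_eq : ∀ y ∈ T, absSum (lin (y.2 0) y.1) = absSum y.1 := fun y hy =>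
    le_antisymm ((hmax _ (skew_mem hy.1)).trans hy.2.ge) (absSum_le_absSum_lin _ _)
  -- Minimality forbids equal nonzero heads, since their cancellation would lower the count.
  obtain ⟨v, hv, hmin⟩ := exists_minimalFor_of_wellFoundedLT (· ∈ T) (fun y => nonzeros y.1) hT
  have hmin : ∀ y ∈ T, nonzeros v.1 ≤ nonzeros y.1 := fun y hy =>
    (le_total _ _).elim id fun h => hmin hy h
  let S := {y ∈ T | nonzeros y.1 = nonzeros v.1}
  have hST : ∀ y ∈ S, skew y ∈ T := fun y hy =>
    ⟨skew_mem hy.1.1, (absSum_eq y hy.1).trans hy.1.2⟩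
  have hS : ∀ y ∈ S, skew y ∈ S := fun y hy => ⟨hST y hy, le_antisymm
    ((nonzeros_lin_le (absSum_eq y hy.1)).1.trans hy.2.le) (hmin _ (hST y hy))⟩
  have hne : ∀ y ∈ S, y.1 0 ≠ 0 → y.1 0 ≠ y.1 1 := fun y hy h0 h1 =>
    ((nonzeros_lin_le (absSum_eq y hy.1)).2 h0 h1).not_ge
      (hy.2.le.trans (hmin _ (hST y hy)))
  by_cases hall : ∀ y ∈ S, y.1 0 = 0
  · have : v.1 = 0 := by
      refine eq_zero_of_heads S Prod.fst skew hS hall ?_ ?_ (z := v) ⟨hv, rfl⟩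
      · intro y _ h h0
        exact ((lin_zero_eq_zero_iff _ _).1 h).symm.trans h0
      · exact fun y _ i => lin_mid _ _ _
    rw [← hv.2, this]
    simp [absSum]
  · exfalso
    push Not at hall
    obtain ⟨y, hy, hy0⟩ := hall
    -- Each entry moves towards the head while the head keeps its sign, so it is eventually compared
    -- with a head of the original sign.
    have hsign : ∀ k (hk : k < m + 2), ∀ y ∈ S, y.1 0 ≠ 0 → 0 ≤ y.1 0 * y.1 ⟨k, hk⟩ := by
      intro k
      induction k with
      | zero => exact fun _ y _ _ => mul_self_nonneg _
      | succ k ih =>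
        intro hk y hy hy0
        obtain ⟨h1, h2⟩ := head_sign (absSum_eq y hy.1) hy0 (hne y hy hy0)
        rcases k with _ | k
        · exact h1
        · have h3 := ih (by omega) _ (hS y hy) (right_ne_zero_of_mul h2.ne')
          have h4 : (skew y).1 ⟨k + 1, by omega⟩ = y.1 ⟨k + 1 + 1, hk⟩ :=
            lin_mid _ _ ⟨k, by omega⟩
          rw [h4] at h3
          -- Both factors have the sign of the new head; its square is then cancelled.
          have h5 : 0 ≤ (y.1 0 * y.1 ⟨k + 1 + 1, hk⟩) * (lin (y.2 0) y.1 0) ^ 2 := by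
            have := mul_nonneg h2.le h3
            simp only [skew] at this
            nlinarith
          exact nonneg_of_mul_nonneg_left h5 (sq_pos_of_ne_zero (right_ne_zero_of_mul h2.ne'))
    have hsum : 0 < ∑ i, y.1 0 * y.1 i :=
      Finset.sum_pos' (fun i _ => hsign i i.isLt y hy hy0)
        ⟨0, Finset.mem_univ _, mul_self_pos.2 hy0⟩
    rw [← Finset.mul_sum, hy.1.1.1, mul_zero] at hsum
    exact hsum.false

/-- Barycentric coordinates lie in `[0, 1]`, so the differences stay in `[-1, 1]` forever, and they
have sum zero. -/
theorem eq_of_same_itinerary {n : ℕ} [NeZero n] {p q : Fin n → ℝ} {a : ℕ → Fin 2}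
    (hp : ∀ t, (tent n)^[t] p ∈ GamSym n (a t)) (hq : ∀ t, (tent n)^[t] q ∈ GamSym n (a t)) :
    p = q := by
  obtain ⟨m, rfl⟩ := Nat.exists_eq_succ_of_ne_zero (NeZero.ne n)
  have hiter : ∀ t, linIter a (bary p - bary q) t =
      bary ((tent (m + 1))^[t] p) - bary ((tent (m + 1))^[t] q) := by
    intro t
    induction t with
    | zero => rfl
    | succ t ih =>
      rw [linIter, ih, ← bary_tent_sub (hp t) (hq t), Function.iterate_succ_apply',
        Function.iterate_succ_apply']
  have hle : ∀ r ∈ Gam (m + 1), ∀ i, bary r i ≤ 1 := fun r hr i =>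
    (Finset.single_le_sum (fun j _ => mem_Gam_iff.1 hr j) (Finset.mem_univ i)).trans
      (sum_bary r).le
  have hmem : (bary p - bary q, a) ∈ boundedOrbits m := by
    refine ⟨by simp [Finset.sum_sub_distrib, sum_bary], fun t i => ?_⟩
    have hp' := GamSym_subset (hp t)
    have hq' := GamSym_subset (hq t)
    have h1 := hle _ hp' i
    have h2 := hle _ hq' i
    have h3 := mem_Gam_iff.1 hp' i
    have h4 := mem_Gam_iff.1 hq' i
    simp only [hiter, Pi.sub_apply]
    exact abs_le.2 ⟨by linarith, by linarith⟩
  exact bary_injective (sub_eq_zero.1 (eq_zero_of_mem_boundedOrbits hmem))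

/-! ### Tent orbits eventually stay in `Γ^o`. -/

theorem nonzeros_bary_tent {m : ℕ} {p : Fin (m + 1) → ℝ} (hp : p ∈ Gam (m + 1)) :
    nonzeros (bary (tent (m + 1) p)) ≤ nonzeros (bary p) ∧
      (bary p 0 ≠ 0 → bary p 0 = bary p 1 →
        nonzeros (bary (tent (m + 1) p)) < nonzeros (bary p)) := by
  have h0 := mem_Gam_iff.1 hp 0
  have h1 := mem_Gam_iff.1 hp 1
  classical
  rw [bary_tent]
  unfold nonzeros
  rw [sum_shift (fun y => if y = 0 then 0 else 1),
    sum_queue (fun y => if y = 0 then 0 else 1) (bary p)]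
  refine ⟨?_, fun h2 h3 => ?_⟩
  · rcases h0.eq_or_lt with h0 | h0
    · rw [← h0, min_eq_left h1]; simp
    · rcases h1.eq_or_lt with h1 | h1
      · rw [← h1, min_eq_right h0.le]; simp
      · simp only [h0.ne', h1.ne', if_false]
        split_ifs <;> omega
  · rw [← h3]; simp [h2]

theorem eventually_mem_GamO {n : ℕ} [NeZero n] {p : Fin n → ℝ} (hp : p ∈ Gam n) :
    ∃ t₀, ∀ t, t₀ ≤ t → (tent n)^[t] p ∈ GamO n := by
  obtain ⟨m, rfl⟩ := Nat.exists_eq_succ_of_ne_zero (NeZero.ne n)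
  have hmem : ∀ t, (tent (m + 1))^[t] p ∈ Gam (m + 1) := fun t => by
    induction t with
    | zero => exact hp
    | succ t ih => rw [Function.iterate_succ_apply']; exact tent_mem ih
  let c : ℕ → ℕ := fun t => nonzeros (bary ((tent (m + 1))^[t] p))
  have hanti : ∀ t, c (t + 1) ≤ c t := fun t => by
    simp only [c, Function.iterate_succ_apply']
    exact (nonzeros_bary_tent (hmem t)).1
  obtain ⟨t₁, ht₁⟩ : ∃ t₁, ∀ t, c t₁ ≤ c t := by
    obtain ⟨t₁, -, h⟩ := exists_minimalFor_of_wellFoundedLT (fun _ : ℕ => True) c ⟨0, trivial⟩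
    exact ⟨t₁, fun t => (le_total _ _).elim id fun h' => h trivial h'⟩
  have hconst : ∀ t, t₁ ≤ t → c t = c t₁ := fun t ht =>
    le_antisymm (antitone_nat_of_succ_le hanti ht) (ht₁ t)
  have hne : ∀ t, t₁ ≤ t → bary ((tent (m + 1))^[t] p) 0 ≠ 0 →
      bary ((tent (m + 1))^[t + 1] p) 0 ≠ 0 := by
    intro t ht h0 h
    rw [Function.iterate_succ_apply', bary_tent, shift_zero, abs_eq_zero, sub_eq_zero] at h
    have := (nonzeros_bary_tent (hmem t)).2 h0 h
    rw [← Function.iterate_succ_apply' (tent (m + 1))] at this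
    exact this.ne ((hconst _ (by omega)).trans (hconst t ht).symm)
  -- If all later heads vanished the queue would be zero, but its entries sum to `1`.
  obtain ⟨t₂, ht₂, h₂⟩ : ∃ t, t₁ ≤ t ∧ bary ((tent (m + 1))^[t] p) 0 ≠ 0 := by
    by_contra! hall
    have h : bary ((tent (m + 1))^[t₁] p) = 0 := by
      refine eq_zero_of_heads {t | t₁ ≤ t} (fun t => bary ((tent (m + 1))^[t] p)) (· + 1)
        (fun t ht => Nat.le_succ_of_le ht) hall ?_ ?_ (z := t₁) (le_refl t₁)
      · intro t _ h h0
        simp only [Function.iterate_succ_apply', bary_tent, shift_zero, abs_eq_zero,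
          sub_eq_zero] at h
        exact h.symm.trans h0
      · intro t _ i
        simp only [Function.iterate_succ_apply', bary_tent, shift_mid]
    have := sum_bary ((tent (m + 1))^[t₁] p)
    simp [h] at this
  refine ⟨t₂, fun t ht => mem_GamO_iff.2 ⟨hmem t, (mem_Gam_iff.1 (hmem t) 0).lt_of_ne' ?_⟩⟩
  induction t, ht using Nat.le_induction with
  | base => exact h₂
  | succ t ht ih => exact hne t (ht₂.trans ht) ih

theorem tent_iterate_mem {n : ℕ} [NeZero n] {p : Fin n → ℝ} (hp : p ∈ Gam n) (t : ℕ) :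
    (tent n)^[t] p ∈ Gam n := by
  induction t with
  | zero => exact hp
  | succ t ih => rw [Function.iterate_succ_apply']; exact tent_mem ih

theorem fin_two_eq_of_ne {a b c : Fin 2} (hab : a ≠ b) : c = a ∨ c = b := by omega

/-! ### Itineraries -/

/-- The sequence `a` is an itinerary of `p` under the tent map. -/
def IsItinerary (n : ℕ) [NeZero n] (p : Fin n → ℝ) (a : ℕ → Fin 2) : Prop :=
  ∀ t, (tent n)^[t] p ∈ GamSym n (a t)

theorem IsItinerary.mem {n : ℕ} [NeZero n] {p : Fin n → ℝ} {a : ℕ → Fin 2}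
    (h : IsItinerary n p a) : p ∈ Gam n := GamSym_subset (h 0)

theorem IsItinerary.tail {n : ℕ} [NeZero n] {p : Fin n → ℝ} {a : ℕ → Fin 2}
    (h : IsItinerary n p a) (t : ℕ) : IsItinerary n ((tent n)^[t] p) fun r => a (r + t) :=
  fun r => by rw [← Function.iterate_add_apply]; exact h _

theorem exists_isItinerary {n : ℕ} [NeZero n] {p : Fin n → ℝ} (hp : p ∈ Gam n) :
    ∃ a, IsItinerary n p a := by
  have h : ∀ t, ∃ a, (tent n)^[t] p ∈ GamSym n a := fun t =>
    (mem_GamSym_or (tent_iterate_mem hp t)).elim (fun h => ⟨0, h⟩) fun h => ⟨1, h⟩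
  exact ⟨fun t => (h t).choose, fun t => (h t).choose_spec⟩

theorem isItinerary_const {n : ℕ} [NeZero n] {a : Fin 2} {z : Fin n → ℝ} (hz : z ∈ Gam n)
    (h : tau n a z = z) : IsItinerary n z fun _ => a := by
  have hT : tent n z = z := by simpa [h] using tent_tau a hz
  intro t
  rw [Function.iterate_fixed hT]
  exact ⟨z, hz, h⟩

theorem tau_eq_of_isItinerary_const {n : ℕ} [NeZero n] {a : Fin 2} {z : Fin n → ℝ}
    (h : IsItinerary n z fun _ => a) : tau n a z = z := by
  have hT : tent n z = z := eq_of_same_itinerary (h.tail 1) h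
  have := tau_tent (h 0)
  rwa [Function.iterate_zero_apply, hT] at this

theorem tauWord_mem {n : ℕ} [NeZero n] (a : ℕ → Fin 2) (t : ℕ) {y : Fin n → ℝ}
    (hy : y ∈ Gam n) : tauWord n a t y ∈ Gam n := by
  induction t generalizing y with
  | zero => exact hy
  | succ t ih => exact ih (tau_mem _ hy)

theorem tent_iterate_tauWord {n : ℕ} [NeZero n] (a : ℕ → Fin 2) (t : ℕ) {y : Fin n → ℝ}
    (hy : y ∈ Gam n) : (tent n)^[t] (tauWord n a t y) = y := by
  induction t generalizing y with
  | zero => rfl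
  | succ t ih =>
    rw [Function.iterate_succ_apply', tauWord, Function.comp_apply, ih (tau_mem _ hy),
      tent_tau _ hy]

theorem IsItinerary.tauWord_tent {n : ℕ} [NeZero n] {p : Fin n → ℝ} {a : ℕ → Fin 2}
    (h : IsItinerary n p a) (t : ℕ) : tauWord n a t ((tent n)^[t] p) = p := by
  induction t with
  | zero => rfl
  | succ t ih =>
    rw [Function.iterate_succ_apply', tauWord, Function.comp_apply, tau_tent (h t), ih]

theorem mem_iInter_GamWord {n : ℕ} [NeZero n] {p : Fin n → ℝ} {a : ℕ → Fin 2} :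
    p ∈ ⋂ t, GamWord n a t ↔ IsItinerary n p a := by
  rw [Set.mem_iInter]
  constructor
  · intro h t
    obtain ⟨y, hy, rfl⟩ := h (t + 1)
    rw [tauWord, Function.comp_apply, tent_iterate_tauWord _ _ (tau_mem _ hy)]
    exact ⟨y, hy, rfl⟩
  · exact fun h t => ⟨_, tent_iterate_mem h.mem t, h.tauWord_tent t⟩

/-- The intersection always consists of the points with itinerary `a`, and there is at most one. -/
theorem isSymbolicOrbit_iff {n : ℕ} [NeZero n] {p : Fin n → ℝ} {a : ℕ → Fin 2} :
    IsSymbolicOrbit n p a ↔ IsItinerary n p a := by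
  constructor
  · intro h
    rw [← mem_iInter_GamWord, h]
    rfl
  · intro h
    refine Set.eq_singleton_iff_unique_mem.2 ⟨mem_iInter_GamWord.2 h, fun q hq => ?_⟩
    exact eq_of_same_itinerary (mem_iInter_GamWord.1 hq) h

theorem existsUnique_isFinalOrbit {n : ℕ} [NeZero n] {p : Fin n → ℝ} (hp : p ∈ Gam n) :
    ∃! a : ℕ → Fin 2, IsFinalOrbit n p a := by
  classical
  refine ⟨fun t => if (tent n)^[t] p ∈ GamSym n 1 then 1 else 0,
    ⟨isSymbolicOrbit_iff.2 fun t => ?_, fun t h => if_pos h.2⟩, fun b hb => funext fun t => ?_⟩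
  · split_ifs with h
    · exact h
    · exact (mem_GamSym_or (tent_iterate_mem hp t)).resolve_right h
  · have h := isSymbolicOrbit_iff.1 hb.1 t
    have h1 := hb.2 t
    rcases fin_two_eq_of_ne (c := b t) zero_ne_one with h' | h' <;> rw [h'] at h h1 ⊢
    · split_ifs with h2
      · exact h1 ⟨h, h2⟩
      · rfl
    · rw [if_pos h]

theorem existsUnique_isStarOrbit {n : ℕ} [NeZero n] {p : Fin n → ℝ} (hp : p ∈ Gam n) :
    ∃! c : ℕ → Option (Fin 2), IsStarOrbit n p c := by
  have h : ∀ t, ∃! c : Option (Fin 2),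
      ((tent n)^[t] p ∈ GamSym n 0 \ GamSym n 1 ∧ c = some 0) ∨
      ((tent n)^[t] p ∈ GamSym n 1 \ GamSym n 0 ∧ c = some 1) ∨
      ((tent n)^[t] p ∈ GamSym n 0 ∩ GamSym n 1 ∧ c = none) := by
    intro t
    have := mem_GamSym_or (tent_iterate_mem hp t)
    by_cases h0 : (tent n)^[t] p ∈ GamSym n 0 <;> by_cases h1 : (tent n)^[t] p ∈ GamSym n 1 <;>
      simp_all
  choose c hc hu using h
  exact ⟨c, hc, fun d hd => funext fun t => hu t _ (hd t)⟩

/-! ### Tails -/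

section Tails

variable {X : Type} {a b c : ℕ → X} {x y : X}

theorem SameTail.symm (h : SameTail a b) : SameTail b a :=
  h.imp fun _ ht r hr => (ht r hr).symm

theorem SameTail.trans (h : SameTail a b) (h' : SameTail b c) : SameTail a c := by
  obtain ⟨t, ht⟩ := h
  obtain ⟨s, hs⟩ := h'
  exact ⟨max t s, fun r hr => (ht r (le_of_max_le_left hr)).trans (hs r (le_of_max_le_right hr))⟩

theorem SameTail.of_shift (t : ℕ) (h : SameTail (fun r => a (r + t)) fun r => b (r + t)) :
    SameTail a b := by
  obtain ⟨s, hs⟩ := h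
  refine ⟨s + t, fun r hr => ?_⟩
  have := hs (r - t) (by omega)
  dsimp only at this
  rwa [Nat.sub_add_cancel (by omega)] at this

theorem sameTail_some_iff {c d : ℕ → Option X} (hc : SameTail c fun t => some (a t))
    (hd : SameTail d fun t => some (b t)) : SameTail c d ↔ SameTail a b := by
  constructor
  · intro h
    obtain ⟨t, ht⟩ := (hc.symm.trans h).trans hd
    exact ⟨t, fun r hr => Option.some_injective _ (ht r hr)⟩
  · rintro ⟨t, ht⟩
    exact (hc.trans ⟨t, fun r hr => congrArg some (ht r hr)⟩).trans hd.symm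

theorem tailRelated_some_iff {c d : ℕ → Option X} (hc : SameTail c fun t => some (a t))
    (hd : SameTail d fun t => some (b t)) :
    TailRelated (some x) (some y) c d ↔ TailRelated x y a b := by
  have hconst : ∀ z : X, SameTail (fun _ : ℕ => some z) fun _ => some z :=
    fun _ => ⟨0, fun _ _ => rfl⟩
  simp only [TailRelated, HasConstTail, sameTail_some_iff hc hd, sameTail_some_iff hc (hconst _),
    sameTail_some_iff hd (hconst _)]

theorem TailRelated.trans (h : TailRelated x y a b) (h' : TailRelated x y b c) :
    TailRelated x y a c := by
  rcases h with h | ⟨h1, h2⟩ | ⟨h1, h2⟩ <;> rcases h' with h' | ⟨h3, h4⟩ | ⟨h3, h4⟩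
  · exact Or.inl (h.trans h')
  · exact Or.inr (Or.inl ⟨h.trans h3, h4⟩)
  · exact Or.inr (Or.inr ⟨h.trans h3, h4⟩)
  · exact Or.inr (Or.inl ⟨h1, h'.symm.trans h2⟩)
  · exact Or.inr (Or.inl ⟨h1, h4⟩)
  · exact Or.inl (SameTail.trans h1 (SameTail.symm h4))
  · exact Or.inr (Or.inr ⟨h1, h'.symm.trans h2⟩)
  · exact Or.inl (SameTail.trans h1 (SameTail.symm h4))
  · exact Or.inr (Or.inr ⟨h1, h4⟩)

theorem TailRelated.symm (h : TailRelated x y a b) : TailRelated x y b a :=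
  h.imp SameTail.symm fun h => h.symm.imp And.symm And.symm

end Tails

/-- At large times the tent orbit of a point avoids `Γ_0 ∩ Γ_1`. -/
theorem eventually_notMem_GamSym {n : ℕ} [NeZero n] {p : Fin n → ℝ} (hp : p ∈ Gam n) :
    ∃ t₀, ∀ t, t₀ ≤ t → ∀ a b : Fin 2, a ≠ b → (tent n)^[t] p ∈ GamSym n a →
      (tent n)^[t] p ∉ GamSym n b := by
  obtain ⟨t₀, h⟩ := eventually_mem_GamO hp
  refine ⟨t₀, fun t ht a b hab ha => ?_⟩
  -- The next point lies in `Γ^o`, and its image under one branch avoids the other half.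
  have := h (t + 1) (by omega)
  rw [Function.iterate_succ_apply'] at this
  have := tau_notMem_GamSym this hab
  rwa [tau_tent ha] at this

theorem IsItinerary.sameTail {n : ℕ} [NeZero n] {p : Fin n → ℝ} {a b : ℕ → Fin 2}
    (ha : IsItinerary n p a) (hb : IsItinerary n p b) : SameTail a b := by
  obtain ⟨t₀, h⟩ := eventually_notMem_GamSym ha.mem
  exact ⟨t₀, fun t ht => by_contra fun hne => h t ht _ _ hne (ha t) (hb t)⟩

theorem IsItinerary.sameTail_of_tent_iterate_eq {n : ℕ} [NeZero n] {p q : Fin n → ℝ}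
    {a b : ℕ → Fin 2} (ha : IsItinerary n p a) (hb : IsItinerary n q b) {t : ℕ}
    (h : (tent n)^[t] p = (tent n)^[t] q) : SameTail a b :=
  .of_shift t ((ha.tail t).sameTail (h ▸ hb.tail t))

theorem IsStarOrbit.sameTail {n : ℕ} [NeZero n] {p : Fin n → ℝ} {c : ℕ → Option (Fin 2)}
    {a : ℕ → Fin 2} (hc : IsStarOrbit n p c) (ha : IsItinerary n p a) :
    SameTail c fun t => some (a t) := by
  obtain ⟨t₀, h⟩ := eventually_notMem_GamSym ha.mem
  refine ⟨t₀, fun t ht => ?_⟩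
  have ha := ha t
  rcases hc t with ⟨h1, h2⟩ | ⟨h1, h2⟩ | ⟨h1, h2⟩
  · rcases fin_two_eq_of_ne (c := a t) zero_ne_one with h' | h'
    · simp only [h2, h']
    · exact absurd (h' ▸ ha) h1.2
  · rcases fin_two_eq_of_ne (c := a t) zero_ne_one with h' | h'
    · exact absurd (h' ▸ ha) h1.2
    · simp only [h2, h']
  · exact absurd h1.2 (h t ht 0 1 zero_ne_one h1.1)

/-! ### The Kakutani-von Neumann transformation -/

theorem tauPow_succ (n : ℕ) (a b : Fin 2) (k : ℕ) (y : Fin n → ℝ) :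
    tauPow n a b (k + 1) y = tau n a (tauPow n a b k y) := by
  simp only [tauPow, Function.comp_apply, Function.iterate_succ_apply']

theorem tauPow_mem {n : ℕ} [NeZero n] (a b : Fin 2) (k : ℕ) {y : Fin n → ℝ} (hy : y ∈ Gam n) :
    tauPow n a b k y ∈ Gam n := by
  induction k with
  | zero => exact tau_mem b hy
  | succ k ih => rw [tauPow_succ]; exact tau_mem a ih

theorem tent_iterate_tauPow {n : ℕ} [NeZero n] (a b : Fin 2) (k : ℕ) {y : Fin n → ℝ}
    (hy : y ∈ Gam n) : (tent n)^[k + 1] (tauPow n a b k y) = y := by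
  induction k with
  | zero => exact tent_tau b hy
  | succ k ih =>
    rw [tauPow_succ, Function.iterate_succ_apply, tent_tau a (tauPow_mem a b k hy), ih]

/-- The exponent is legible from the point: on `Γ^o` the image of `τ_b` misses `Γ_a`, so the leading
`τ_a` can be stripped one by one. It gives disjointness of the domains of `K` (`a = 1`) and of its
images (`a = 0`). -/
theorem tauPow_inj {n : ℕ} [NeZero n] {a b : Fin 2} (hab : b ≠ a) {y y' : Fin n → ℝ}
    (hy : y ∈ GamO n) (hy' : y' ∈ GamO n) {k k' : ℕ}
    (h : tauPow n a b k y = tauPow n a b k' y') : k = k' ∧ y = y' := by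
  induction k generalizing k' with
  | zero =>
    rcases k' with _ | k'
    · exact ⟨rfl, tau_injOn b (GamO_subset hy) (GamO_subset hy') h⟩
    · rw [tauPow_succ] at h
      exact absurd ⟨_, tauPow_mem a b k' (GamO_subset hy'), h.symm⟩ (tau_notMem_GamSym hy hab)
  | succ k ih =>
    rcases k' with _ | k'
    · rw [tauPow_succ] at h
      exact absurd ⟨_, tauPow_mem a b k (GamO_subset hy), h⟩ (tau_notMem_GamSym hy' hab)
    · rw [tauPow_succ, tauPow_succ] at h
      have := ih (tau_injOn a (tauPow_mem a b k (GamO_subset hy))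
        (tauPow_mem a b k' (GamO_subset hy')) h)
      exact ⟨congrArg _ this.1, this.2⟩

theorem tauPow_ne_of_fixed {n : ℕ} [NeZero n] {a b : Fin 2} (hab : b ≠ a) {y z : Fin n → ℝ}
    (hy : y ∈ GamO n) (hz : z ∈ Gam n) (hfix : tau n a z = z) (k : ℕ) :
    tauPow n a b k y ≠ z := by
  induction k with
  | zero =>
    intro h
    exact tau_notMem_GamSym hy hab ⟨z, hz, hfix.trans h.symm⟩
  | succ k ih =>
    intro h
    rw [tauPow_succ, ← hfix] at h
    exact ih (tau_injOn a (tauPow_mem a b k (GamO_subset hy)) hz h)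

/-- The domains of the branches of `K` cover the simplex. -/
theorem isVNegOne_or_eq_tauPow {n : ℕ} [NeZero n] {p : Fin n → ℝ} (hp : p ∈ Gam n) :
    IsVNegOne n p ∨ ∃ k, ∃ y ∈ GamO n, tauPow n 1 0 k y = p := by
  refine or_iff_not_imp_right.2 fun hno => isVNegOne_iff.2 ⟨hp, ?_⟩
  refine tau_eq_of_isItinerary_const fun t => ?_
  induction t generalizing p with
  | zero =>
    rcases mem_GamSym_or hp with ⟨y, hy, rfl⟩ | h
    · have hyo : y ∉ GamO n := fun h => hno ⟨0, y, h, rfl⟩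
      exact ⟨y, hy, tau_eq_of_notMem_GamO hy hyo _ _⟩
    · exact h
  | succ t ih =>
    have h1 : p ∈ GamSym n 1 := by
      rcases mem_GamSym_or hp with ⟨y, hy, rfl⟩ | h
      · have hyo : y ∉ GamO n := fun h => hno ⟨0, y, h, rfl⟩
        exact ⟨y, hy, tau_eq_of_notMem_GamO hy hyo _ _⟩
      · exact h
    refine ih (tent_mem hp) ?_
    rintro ⟨k, y, hy, h⟩
    exact hno ⟨k + 1, y, hy, by rw [tauPow_succ, h, tau_tent h1]⟩

theorem K_of_isVNegOne {n : ℕ} {p : Fin n → ℝ} (h : IsVNegOne n p) : K n p = vertex n 0 :=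
  if_pos h

/-- By `tauPow_inj` the chosen exponent and preimage in the definition of `K` are forced to be `k`
and `y`. -/
theorem K_tauPow {n : ℕ} [NeZero n] {y : Fin n → ℝ} (hy : y ∈ GamO n) (k : ℕ) :
    K n (tauPow n 1 0 k y) = tauPow n 0 1 k y := by
  have hv : ¬ IsVNegOne n (tauPow n 1 0 k y) := fun h =>
    tauPow_ne_of_fixed zero_ne_one hy h.1 (isVNegOne_iff.1 h).2 k rfl
  have h : ∃ k', tauPow n 1 0 k y ∈ tauPow n 1 0 k' '' GamO n := ⟨k, y, hy, rfl⟩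
  rw [K, if_neg hv, dif_pos h]
  have h1 := Function.invFunOn_mem h.choose_spec
  have h2 := Function.invFunOn_eq h.choose_spec
  obtain ⟨h3, h4⟩ := tauPow_inj zero_ne_one h1 hy h2
  rw [h4, h3]

theorem vertex_zero_mem (n : ℕ) [NeZero n] : vertex n 0 ∈ Gam n :=
  GamO_subset (vertex_zero_mem_GamO n)

theorem K_mem {n : ℕ} [NeZero n] {p : Fin n → ℝ} (hp : p ∈ Gam n) : K n p ∈ Gam n := by
  rcases isVNegOne_or_eq_tauPow hp with h | ⟨k, y, hy, rfl⟩
  · rw [K_of_isVNegOne h]; exact vertex_zero_mem n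
  · rw [K_tauPow hy]; exact tauPow_mem _ _ _ (GamO_subset hy)

theorem K_injOn (n : ℕ) [NeZero n] : Set.InjOn (K n) (Gam n) := by
  have hne : ∀ (k : ℕ), ∀ y ∈ GamO n, tauPow n 0 1 k y ≠ vertex n 0 := fun k y hy =>
    tauPow_ne_of_fixed one_ne_zero hy (vertex_zero_mem n) (tau_vertex_zero n) k
  intro p hp q hq h
  rcases isVNegOne_or_eq_tauPow hp with hp' | ⟨k, y, hy, rfl⟩ <;>
    rcases isVNegOne_or_eq_tauPow hq with hq' | ⟨l, z, hz, rfl⟩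
  · exact eq_of_same_itinerary (isItinerary_const hp (isVNegOne_iff.1 hp').2)
      (isItinerary_const hq (isVNegOne_iff.1 hq').2)
  · rw [K_of_isVNegOne hp', K_tauPow hz] at h
    exact absurd h.symm (hne l z hz)
  · rw [K_of_isVNegOne hq', K_tauPow hy] at h
    exact absurd h (hne k y hy)
  · rw [K_tauPow hy, K_tauPow hz] at h
    obtain ⟨rfl, rfl⟩ := tauPow_inj one_ne_zero hy hz h
    rfl

theorem K_iterate_mem {n : ℕ} [NeZero n] {p : Fin n → ℝ} (hp : p ∈ Gam n) (m : ℕ) :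
    (K n)^[m] p ∈ Gam n := by
  induction m with
  | zero => exact hp
  | succ m ih => rw [Function.iterate_succ_apply']; exact K_mem ih

/-- Injectivity of `K` cancels common iterates; the symmetric form makes transitivity easy. -/
theorem sameKOrbit_iff {n : ℕ} [NeZero n] {p q : Fin n → ℝ} (hp : p ∈ Gam n) (hq : q ∈ Gam n) :
    SameKOrbit n p q ↔ ∃ m l, (K n)^[m] p = (K n)^[l] q := by
  have cancel : ∀ l : ℕ, ∀ p ∈ Gam n, ∀ q ∈ Gam n, (K n)^[l] p = (K n)^[l] q → p = q := by
    intro l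
    induction l with
    | zero => exact fun p _ q _ h => h
    | succ l ih => exact fun p hp q hq h => K_injOn n hp hq (ih _ (K_mem hp) _ (K_mem hq) h)
  constructor
  · rintro ⟨m, h | h⟩
    · exact ⟨m, 0, h⟩
    · exact ⟨0, m, h.symm⟩
  · rintro ⟨m, l, h⟩
    rcases le_total m l with hml | hml
    · obtain ⟨r, rfl⟩ := Nat.exists_eq_add_of_le hml
      rw [Function.iterate_add_apply] at h
      exact ⟨r, Or.inr (cancel m p hp _ (K_iterate_mem hq r) h).symm⟩
    · obtain ⟨r, rfl⟩ := Nat.exists_eq_add_of_le hml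
      rw [Function.iterate_add_apply] at h
      exact ⟨r, Or.inl (cancel l _ (K_iterate_mem hp r) q hq h)⟩

theorem SameKOrbit.refl {n : ℕ} (p : Fin n → ℝ) : SameKOrbit n p p := ⟨0, Or.inl rfl⟩

theorem SameKOrbit.symm {n : ℕ} {p q : Fin n → ℝ} (h : SameKOrbit n p q) : SameKOrbit n q p :=
  h.imp fun _ => Or.symm

theorem SameKOrbit.trans {n : ℕ} [NeZero n] {p q r : Fin n → ℝ} (hp : p ∈ Gam n)
    (hq : q ∈ Gam n) (hr : r ∈ Gam n) (h : SameKOrbit n p q) (h' : SameKOrbit n q r) :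
    SameKOrbit n p r := by
  obtain ⟨m, l, h⟩ := (sameKOrbit_iff hp hq).1 h
  obtain ⟨m', l', h'⟩ := (sameKOrbit_iff hq hr).1 h'
  refine (sameKOrbit_iff hp hr).2 ⟨m' + m, l + l', ?_⟩
  rw [Function.iterate_add_apply, h, ← Function.iterate_add_apply, Nat.add_comm,
    Function.iterate_add_apply, h', ← Function.iterate_add_apply]

/-! ### `K`-orbits and tails of itineraries. -/

theorem tauWord_const (n : ℕ) (a : Fin 2) (t : ℕ) : tauWord n (fun _ => a) t = (tau n a)^[t] := by
  induction t with
  | zero => rfl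
  | succ t ih => rw [tauWord, ih, Function.iterate_succ]

/-- All the points `τ_{a_0} ⋯ τ_{a_{t-1}} x`, for fixed `t` and `x`, are in one `K`-orbit. -/
theorem sameKOrbit_tauWord {n : ℕ} [NeZero n] (a b : ℕ → Fin 2) (t : ℕ) {x : Fin n → ℝ}
    (hx : x ∈ Gam n) : SameKOrbit n (tauWord n a t x) (tauWord n b t x) := by
  induction t generalizing a b x with
  | zero => exact .refl x
  | succ t ih =>
    have hT : ∀ c i, tauWord n c t (tau n i x) ∈ Gam n := fun c i =>
      tauWord_mem c t (tau_mem i hx)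
    -- By induction, the words ending in `0` and those ending in `1` form two classes. One
    -- application of `K`, the odometer's carry, joins them; off `Γ^o` the two classes have the same
    -- base point.
    have link : SameKOrbit n (tauWord n (fun _ => 1) t (tau n 0 x))
        (tauWord n (fun _ => 0) t (tau n 1 x)) := by
      by_cases ho : x ∈ GamO n
      · refine ⟨1, Or.inl ?_⟩
        rw [tauWord_const, tauWord_const]
        exact K_tauPow ho t
      · rw [tau_eq_of_notMem_GamO hx ho 0 1]
        exact ih _ _ (tau_mem _ hx)
    have link' : ∀ c d, SameKOrbit n (tauWord n c t (tau n 0 x)) (tauWord n d t (tau n 1 x)) :=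
      fun c d => ((ih c _ (tau_mem 0 hx)).trans (hT _ _) (hT _ _) (hT _ _) link).trans
        (hT _ _) (hT _ _) (hT _ _) (ih _ d (tau_mem 1 hx))
    simp only [tauWord, Function.comp_apply]
    rcases fin_two_eq_of_ne (c := a t) zero_ne_one with h | h <;>
      rcases fin_two_eq_of_ne (c := b t) zero_ne_one with h' | h' <;> rw [h, h']
    · exact ih _ _ (tau_mem _ hx)
    · exact link' _ _
    · exact (link' _ _).symm
    · exact ih _ _ (tau_mem _ hx)

theorem IsItinerary.sameKOrbit_of_sameTail {n : ℕ} [NeZero n] {p q : Fin n → ℝ}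
    {a b : ℕ → Fin 2} (ha : IsItinerary n p a) (hb : IsItinerary n q b) (h : SameTail a b) :
    SameKOrbit n p q := by
  obtain ⟨t, ht⟩ := h
  have heq : (tent n)^[t] p = (tent n)^[t] q := by
    refine eq_of_same_itinerary (ha.tail t) fun r => ?_
    rw [ht _ (Nat.le_add_left t r)]
    exact hb.tail t r
  have h := sameKOrbit_tauWord a b t (tent_iterate_mem ha.mem t)
  rwa [ha.tauWord_tent, heq, hb.tauWord_tent] at h

/-- A tail `0^∞` puts `p` in the orbit of `v_0`, a tail `1^∞` puts `q` in that of `v_{-1}`, and `K`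
maps `v_{-1}` to `v_0`. -/
theorem sameKOrbit_of_constTails {n : ℕ} [NeZero n] {p q : Fin n → ℝ}
    {a b : ℕ → Fin 2} (ha : IsItinerary n p a) (hb : IsItinerary n q b) (ha0 : HasConstTail a 0)
    (hb1 : HasConstTail b 1) : SameKOrbit n p q := by
  have h0 : SameKOrbit n p (vertex n 0) := ha.sameKOrbit_of_sameTail
    (isItinerary_const (vertex_zero_mem n) (tau_vertex_zero n)) ha0
  obtain ⟨t, ht⟩ := id hb1
  have hv : IsItinerary n ((tent n)^[t] q) fun _ => 1 := by
    have := hb.tail t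
    rwa [funext fun r => ht (r + t) (Nat.le_add_left t r)] at this
  have h1 : SameKOrbit n q ((tent n)^[t] q) := hb.sameKOrbit_of_sameTail hv hb1
  have h2 : SameKOrbit n ((tent n)^[t] q) (vertex n 0) :=
    ⟨1, Or.inl (K_of_isVNegOne (isVNegOne_iff.2 ⟨hv.mem, tau_eq_of_isItinerary_const hv⟩))⟩
  exact h0.trans ha.mem (vertex_zero_mem n) hb.mem
    (h1.trans hb.mem hv.mem (vertex_zero_mem n) h2).symm

theorem IsItinerary.tailRelated_K {n : ℕ} [NeZero n] {p : Fin n → ℝ} {a b : ℕ → Fin 2}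
    (ha : IsItinerary n p a) (hb : IsItinerary n (K n p) b) : TailRelated 0 1 a b := by
  rcases isVNegOne_or_eq_tauPow ha.mem with h | ⟨k, y, hy, rfl⟩
  · rw [K_of_isVNegOne h] at hb
    exact Or.inr (Or.inr ⟨ha.sameTail (isItinerary_const ha.mem (isVNegOne_iff.1 h).2),
      hb.sameTail (isItinerary_const (vertex_zero_mem n) (tau_vertex_zero n))⟩)
  · rw [K_tauPow hy] at hb
    refine Or.inl (ha.sameTail_of_tent_iterate_eq hb (t := k + 1) ?_)
    rw [tent_iterate_tauPow _ _ _ (GamO_subset hy), tent_iterate_tauPow _ _ _ (GamO_subset hy)]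

theorem IsItinerary.tailRelated_K_iterate {n : ℕ} [NeZero n] {p : Fin n → ℝ} {a b : ℕ → Fin 2}
    (m : ℕ) (ha : IsItinerary n p a) (hb : IsItinerary n ((K n)^[m] p) b) :
    TailRelated 0 1 a b := by
  induction m generalizing p a with
  | zero => exact Or.inl (ha.sameTail hb)
  | succ m ih =>
    obtain ⟨c, hc⟩ := exists_isItinerary (K_mem ha.mem)
    exact (ha.tailRelated_K hc).trans (ih hc hb)

theorem IsItinerary.sameKOrbit_iff {n : ℕ} [NeZero n] {p q : Fin n → ℝ} {a b : ℕ → Fin 2}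
    (ha : IsItinerary n p a) (hb : IsItinerary n q b) :
    SameKOrbit n p q ↔ TailRelated 0 1 a b := by
  constructor
  · rintro ⟨m, rfl | rfl⟩
    · exact ha.tailRelated_K_iterate m hb
    · exact (hb.tailRelated_K_iterate m ha).symm
  · rintro (h | ⟨h0, h1⟩ | ⟨h1, h0⟩)
    · exact ha.sameKOrbit_of_sameTail hb h
    · exact sameKOrbit_of_constTails ha hb h0 h1
    · exact (sameKOrbit_of_constTails hb ha h0 h1).symm

end KakutaniTent

end

theorem mainTheorem8 (n : ℕ) [NeZero n] (p q : Fin n → ℝ)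
    (hp : p ∈ KakutaniTent.Gam n) (hq : q ∈ KakutaniTent.Gam n) :
    -- the final orbit and the `*`-orbit of a point exist and are unique
    ((∃! a : ℕ → Fin 2, KakutaniTent.IsFinalOrbit n p a) ∧
      (∃! c : ℕ → Option (Fin 2), KakutaniTent.IsStarOrbit n p c)) ∧
    -- the criterion in terms of the final orbits
    (∀ a b : ℕ → Fin 2, KakutaniTent.IsFinalOrbit n p a → KakutaniTent.IsFinalOrbit n q b →
      (KakutaniTent.SameKOrbit n p q ↔ KakutaniTent.TailRelated 0 1 a b)) ∧
    -- the criterion in terms of arbitrary symbolic orbits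
    (∀ a b : ℕ → Fin 2, KakutaniTent.IsSymbolicOrbit n p a → KakutaniTent.IsSymbolicOrbit n q b →
      (KakutaniTent.SameKOrbit n p q ↔ KakutaniTent.TailRelated 0 1 a b)) ∧
    -- the criterion in terms of the `*`-orbits
    (∀ c d : ℕ → Option (Fin 2), KakutaniTent.IsStarOrbit n p c → KakutaniTent.IsStarOrbit n q d →
      (KakutaniTent.SameKOrbit n p q ↔ KakutaniTent.TailRelated (some 0) (some 1) c d)) := by
  refine ⟨⟨KakutaniTent.existsUnique_isFinalOrbit hp, KakutaniTent.existsUnique_isStarOrbit hp⟩,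
    fun a b ha hb => ?_, fun a b ha hb => ?_, fun c d hc hd => ?_⟩
  · exact (KakutaniTent.isSymbolicOrbit_iff.1 ha.1).sameKOrbit_iff
      (KakutaniTent.isSymbolicOrbit_iff.1 hb.1)
  · exact (KakutaniTent.isSymbolicOrbit_iff.1 ha).sameKOrbit_iff
      (KakutaniTent.isSymbolicOrbit_iff.1 hb)
  · obtain ⟨a, ha⟩ := KakutaniTent.exists_isItinerary hp
    obtain ⟨b, hb⟩ := KakutaniTent.exists_isItinerary hq
    rw [ha.sameKOrbit_iff hb,
      KakutaniTent.tailRelated_some_iff (hc.sameTail ha) (hd.sameTail hb)]
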